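/- **Setting.** A parametric Markov chain has a finite state set $S$, an initial state $s_{init}\in S$, a finite set $V$ of real parameters and a transition function $\mathcal P\colon S\times S\to\mathbb Q[V]$. Its parameter space is the set of well-defined instantiations, i.e. of those $u\in\mathbb R^V$ for which $\mathcal P(s,s')[u]\ge 0$ for all $s,s'$ and $\sum_{s'}\mathcal P(s,s')[u]=1$ for all $s$; such a $u$ induces a Markov chain $\mathcal D[u]$ on $S$. An uncertain Markov chain $\mathcal D_{\mathbb P}$ is a parametric Markov chain $\mathcal D$ together with a Borel probability distribution $\mathbb P$ over its parameter space. For $T\subseteq S$ and $\lambda\in[0,1]$, $\mathcal D[u]$ satisfies the reachability specification $\varphi_r$ if the probability that $\mathcal D[u]$, started in $s_{init}$, ever visits $T$ is at most $\lambda$. The satisfaction probability is $F(\mathcal D_{\mathbb P},\varphi_r)=\int I_{\varphi_r}(u)\,d\mathbb P(u)$, where $I_{\varphi_r}(u)=1$ if $\mathcal D[u]$ satisfies $\varphi_r$ and $I_{\varphi_r}(u)=0$ otherwise. **Theorem.** Let $\mathcal D_{\mathbb P}$ be an uncertain Markov chain, $\varphi_r$ a reachability specification as above, $K\ge 2$ and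 $\nu\in[0,1)$. Draw $K$ independent samples $\mathcal U=(u_1,\dots,u_K)$ from $\mathbb P$, and let $\mathcal Q$ be the set of (indices of) samples $u_i$ for which $\mathcal D[u_i]$ violates $\varphi_r$; these are discarded. For $L\in\mathbb N$ put $$\alpha_\nu(L)=\binom{L+1}{L}\sum_{i=0}^{L+1}\binom Ki(1-\nu)^{K-i}\nu^i .$$ Then one can conclude $F(\mathcal D_{\mathbb P},\varphi_r)\ge 1-\nu$ with confidence at least $1-\alpha_\nu(L)$ when $L=|\mathcal Q|$ samples have been discarded, in the following sense, where probabilities are with respect to the draw of $\mathcal U$: 1. For every $L\in\mathbb N$, with probability at least $1-\alpha_\nu(L)$ the implication "if $|\mathcal Q|=L$, then $F(\mathcal D_{\mathbb P},\varphi_r)\ge 1-\nu$" holds. 2. For every $\beta\ge 0$, with probability at least $1-\beta$ the implication "if $\alpha_\nu(|\mathcal Q|)\le\beta$, then $F(\mathcal D_{\mathbb P},\varphi_r)\ge 1-\nu$" holds. -/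

import Mathlib

open MeasureTheory ProbabilityTheory

/-- A finite discrete-time Markov chain with initial state `init` and transition
probabilities `trans s s'`. -/
structure MarkovChain (S : Type*) [Fintype S] where
  init : S
  trans : S → S → ℝ
  trans_nonneg : ∀ s s', 0 ≤ trans s s'
  trans_sum : ∀ s, ∑ s', trans s s' = 1

namespace MarkovChain

variable {S : Type*} [Fintype S] (D : MarkovChain S)

/-- The distribution of the successor of the state `s`. -/
noncomputable def stepPMF (s : S) : PMF S :=
  PMF.ofFintype (fun s' => ENNReal.ofReal (D.trans s s')) (by
    rw [← ENNReal.ofReal_sum_of_nonneg (fun s' _ => D.trans_nonneg s s'), D.trans_sum s,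
      ENNReal.ofReal_one])

variable [MeasurableSpace S] [DiscreteMeasurableSpace S]

/-- The one-step transition kernel of the Markov chain. -/
noncomputable def stepKernel : Kernel S S where
  toFun s := (D.stepPMF s).toMeasure
  measurable' := Measurable.of_discrete

instance : IsMarkovKernel D.stepKernel :=
  ⟨fun s => PMF.toMeasure.isProbabilityMeasure (D.stepPMF s)⟩

/-- The step from time `n` to time `n + 1`, as a kernel depending on the history of states up to
time `n` (only through its last state). -/
noncomputable def historyKernel (n : ℕ) : Kernel (Π _ : Finset.Iic n, S) S :=
  D.stepKernel.comap (fun x => x ⟨n, Finset.mem_Iic.2 le_rfl⟩) (measurable_pi_apply _)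

instance (n : ℕ) : IsMarkovKernel (D.historyKernel n) :=
  inferInstanceAs (IsMarkovKernel (D.stepKernel.comap _ _))

/-- The law on the space of infinite paths of the chain started in its initial state. -/
noncomputable def pathMeasure : Measure (ℕ → S) :=
  Kernel.trajMeasure (X := fun _ => S) (Measure.dirac D.init) D.historyKernel

/-- The probability of finally reaching the set `T` from the initial state. -/
noncomputable def reachProb (T : Set S) : ℝ :=
  D.pathMeasure.real {ω | ∃ n, ω n ∈ T}

/-- The chain satisfies the reachability specification with target set `T` and threshold `lam`:
`T` is reached with probability at most `lam`. -/
def Satisfies (lam : ℝ) (T : Set S) : Prop :=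
  D.reachProb T ≤ lam

end MarkovChain

/-- A parametric Markov chain with finite state space `S` and finite set of parameters `V`: its
transitions are labelled by polynomials with rational coefficients in the parameters. -/
structure ParametricMC (S V : Type*) where
  init : S
  trans : S → S → MvPolynomial V ℚ

namespace ParametricMC

variable {S V : Type*} [Fintype S] (D : ParametricMC S V)

/-- The parameter space: the well-defined instantiations, that is, the parameter values for which
the instantiated transition function consists of probability distributions. -/
def paramSpace : Set (V → ℝ) :=
  {v | (∀ s s', 0 ≤ MvPolynomial.aeval v (D.trans s s')) ∧
    ∀ s, ∑ s', MvPolynomial.aeval v (D.trans s s') = (1 : ℝ)}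

/-- The Markov chain obtained by instantiating the parameters. -/
noncomputable def instantiate (u : D.paramSpace) : MarkovChain S where
  init := D.init
  trans s s' := MvPolynomial.aeval u.1 (D.trans s s')
  trans_nonneg := u.2.1
  trans_sum := u.2.2

end ParametricMC

/-- An uncertain Markov chain: a parametric Markov chain together with a (Borel) probability
distribution over its parameter space. -/
structure UncertainMC (S V : Type*) [Fintype S] extends ParametricMC S V where
  prob : ProbabilityMeasure toParametricMC.paramSpace

namespace UncertainMC

variable {S V : Type*} [Fintype S] (M : UncertainMC S V)

/-- The law of `K` independent samples from the distribution over the parameter space. -/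
noncomputable def sampleMeasure (K : ℕ) : Measure (Fin K → M.paramSpace) :=
  Measure.pi fun _ => (M.prob : Measure M.paramSpace)

variable [MeasurableSpace S] [DiscreteMeasurableSpace S]

/-- The instantiations whose induced Markov chain satisfies the reachability specification. -/
def satSet (lam : ℝ) (T : Set S) : Set M.paramSpace :=
  {u | (M.instantiate u).Satisfies lam T}

/-- The satisfaction probability: the integral over the parameter space of the indicator function
of the satisfying instantiations. -/
noncomputable def satProb (lam : ℝ) (T : Set S) : ℝ :=
  ∫ u, (M.satSet lam T).indicator (fun _ => (1 : ℝ)) u ∂(M.prob : Measure M.paramSpace)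

/-- The (indices of the) samples that violate the specification; these are discarded. -/
def violating (lam : ℝ) (T : Set S) {K : ℕ} (U : Fin K → M.paramSpace) : Set (Fin K) :=
  {i | ¬ (M.instantiate (U i)).Satisfies lam T}

end UncertainMC

/-- The confidence probability for `K` samples, `L` of which are discarded, and tolerance
probability `ν`. -/
noncomputable def confidenceProb (K L : ℕ) (ν : ℝ) : ℝ :=
  ((L + 1).choose L : ℝ) *
    ∑ i ∈ Finset.range (L + 2), (K.choose i : ℝ) * (1 - ν) ^ (K - i) * ν ^ i

/-! The satisfaction probability F is a fixed number, so if F ≥ 1 - ν both implications hold for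
every sample. Otherwise a sample violates the specification with probability p = 1 - F > ν, and the
number of violations is binomial (`pi_real_ncard_le`). Seeing at most L of them has probability
`binomialCDF K L p`, which is at most `binomialCDF K L ν` (`binomialCDF_antitone`) and hence at most
α_ν(L). For a data-dependent L, the bad event lies in {|Q| ≤ m}, with m the largest admissible
count. Independence of the violation events needs the satisfying set to be measurable: reachability
is a limit of finite-horizon probabilities, each a polynomial in the transition probabilities
(`measurable_reachProb`). -/

/-- The probability of at most `L` successes in `K` independent trials with success
probability `p`. -/
noncomputable def binomialCDF (K L : ℕ) (p : ℝ) : ℝ :=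
  ∑ i ∈ Finset.range (L + 1), (K.choose i : ℝ) * (1 - p) ^ (K - i) * p ^ i

/-! ### Binomial tails -/

theorem binomial_term_nonneg {p : ℝ} (h0 : 0 ≤ p) (h1 : p ≤ 1) (K i : ℕ) :
    0 ≤ (K.choose i : ℝ) * (1 - p) ^ (K - i) * p ^ i := by
  have := sub_nonneg.2 h1
  positivity

theorem binomialCDF_nonneg {p : ℝ} (h0 : 0 ≤ p) (h1 : p ≤ 1) (K L : ℕ) :
    0 ≤ binomialCDF K L p :=
  Finset.sum_nonneg fun i _ => binomial_term_nonneg h0 h1 K i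

theorem binomialCDF_mono {p : ℝ} (h0 : 0 ≤ p) (h1 : p ≤ 1) (K : ℕ) :
    Monotone fun L => binomialCDF K L p := fun _ _ h =>
  Finset.sum_le_sum_of_subset_of_nonneg (Finset.range_mono (Nat.succ_le_succ h))
    fun i _ _ => binomial_term_nonneg h0 h1 K i

/-- Pascal's rule, conditioning on one trial. The case `K < i + 1` is separate because the exponents
use truncated subtraction. -/
theorem binomial_term_succ (K i : ℕ) (p : ℝ) :
    ((K + 1).choose (i + 1) : ℝ) * (1 - p) ^ (K + 1 - (i + 1)) * p ^ (i + 1) =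
      (1 - p) * ((K.choose (i + 1) : ℝ) * (1 - p) ^ (K - (i + 1)) * p ^ (i + 1)) +
        p * ((K.choose i : ℝ) * (1 - p) ^ (K - i) * p ^ i) := by
  rw [Nat.choose_succ_succ, Nat.add_sub_add_right]
  rcases lt_or_ge K (i + 1) with h | h
  · simp only [Nat.choose_eq_zero_of_lt h]
    push_cast
    ring
  · obtain ⟨j, rfl⟩ := Nat.exists_eq_add_of_le h
    rw [show i + 1 + j - i = j + 1 by omega, show i + 1 + j - (i + 1) = j by omega]
    push_cast
    ring

theorem binomialCDF_succ_zero (K : ℕ) (p : ℝ) :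
    binomialCDF (K + 1) 0 p = (1 - p) * binomialCDF K 0 p := by
  simp [binomialCDF, pow_succ']

theorem binomialCDF_succ_succ (K L : ℕ) (p : ℝ) :
    binomialCDF (K + 1) (L + 1) p =
      (1 - p) * binomialCDF K (L + 1) p + p * binomialCDF K L p := by
  unfold binomialCDF
  rw [Finset.sum_range_succ' _ (L + 1), Finset.sum_congr rfl fun i _ => binomial_term_succ K i p,
    Finset.sum_add_distrib, ← Finset.mul_sum, ← Finset.mul_sum,
    Finset.sum_range_succ' (fun i => (K.choose i : ℝ) * (1 - p) ^ (K - i) * p ^ i) (L + 1)]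
  simp only [Nat.choose_zero_right, Nat.sub_zero, pow_zero, Nat.cast_one]
  ring

/-- The binomial distribution function decreases in the success probability. -/
theorem binomialCDF_antitone {ν p : ℝ} (hν : 0 ≤ ν) (hνp : ν ≤ p) (hp : p ≤ 1) (K L : ℕ) :
    binomialCDF K L p ≤ binomialCDF K L ν := by
  have h1p := sub_nonneg.2 hp
  induction K generalizing L with
  | zero => simp [binomialCDF, Finset.sum_range_succ']
  | succ K ih =>
    cases L with
    | zero =>
      rw [binomialCDF_succ_zero, binomialCDF_succ_zero]
      exact mul_le_mul (by linarith) (ih 0)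
        (binomialCDF_nonneg (hν.trans hνp) hp K 0) (by linarith)
    | succ L =>
      rw [binomialCDF_succ_succ, binomialCDF_succ_succ]
      -- Raising ν to p moves weight p - ν from the larger value, at `L + 1`, to the smaller one, at
      -- `L`.
      have hmono : binomialCDF K L ν ≤ binomialCDF K (L + 1) ν :=
        binomialCDF_mono hν (hνp.trans hp) K L.le_succ
      have ha := mul_le_mul_of_nonneg_left (ih (L + 1)) h1p
      have hb := mul_le_mul_of_nonneg_left (ih L) (hν.trans hνp)
      have hc := mul_le_mul_of_nonneg_left hmono (sub_nonneg.2 hνp)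
      linarith

theorem confidenceProb_eq (K L : ℕ) (ν : ℝ) :
    confidenceProb K L ν = (L + 1 : ℝ) * binomialCDF K (L + 1) ν := by
  simp [confidenceProb, binomialCDF]

/-- Both the factor L + 1 and the summand i = L + 1 of the confidence bound are slack here. -/
theorem binomialCDF_le_confidenceProb {ν p : ℝ} (hν : 0 ≤ ν) (hνp : ν ≤ p) (hp : p ≤ 1)
    (K L : ℕ) : binomialCDF K L p ≤ confidenceProb K L ν := by
  rw [confidenceProb_eq]
  have h0 := binomialCDF_nonneg hν (hνp.trans hp) K (L + 1)
  have h1 : binomialCDF K L ν ≤ binomialCDF K (L + 1) ν :=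
    binomialCDF_mono hν (hνp.trans hp) K L.le_succ
  have h2 : (0 : ℝ) ≤ L := L.cast_nonneg
  nlinarith [binomialCDF_antitone hν hνp hp K L, mul_nonneg h2 h0]

theorem sum_range_filter_le (K L : ℕ) (p : ℝ) :
    ∑ i ∈ Finset.range (K + 1), (K.choose i : ℝ) *
      (if i ≤ L then (1 - p) ^ (K - i) * p ^ i else 0) = binomialCDF K L p := by
  simp only [mul_ite, mul_zero, ← mul_assoc]
  rw [← Finset.sum_filter, binomialCDF]
  -- The ranges differ only by indices above `K`, where the binomial coefficient vanishes.
  refine Finset.sum_subset_zero_on_sdiff (fun i hi => ?_) (fun i hi => ?_) fun _ _ => rfl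
  · simp only [Finset.mem_filter, Finset.mem_range] at hi ⊢
    omega
  · simp only [Finset.mem_sdiff, Finset.mem_filter, Finset.mem_range, not_and] at hi
    rw [Nat.choose_eq_zero_of_lt (by omega)]
    simp

/-! ### Counting successes in independent trials -/

section IndependentTrials

variable {Ω : Type*} [MeasurableSpace Ω] (μ : Measure Ω) [IsProbabilityMeasure μ]

/-- Prescribing exactly which trials succeed gives a box, so its product measure factors. -/
theorem pi_real_setOf_mem_eq {A : Set Ω} (hA : MeasurableSet A) {K : ℕ} (s : Finset (Fin K)) :
    (Measure.pi fun _ : Fin K => μ).real {U | ∀ i, U i ∈ A ↔ i ∈ s} =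
      (1 - μ.real A) ^ (K - s.card) * μ.real A ^ s.card := by
  have hset : {U : Fin K → Ω | ∀ i, U i ∈ A ↔ i ∈ s} =
      Set.univ.pi fun i => if i ∈ s then A else Aᶜ := by
    ext U
    simp only [Set.mem_ofPred_eq, Set.mem_univ_pi]
    refine forall_congr' fun i => ?_
    by_cases h : i ∈ s <;> simp [h]
  rw [hset, measureReal_def, Measure.pi_pi, ENNReal.toReal_prod]
  have hterm : ∀ i : Fin K, (μ (if i ∈ s then A else Aᶜ)).toReal =
      if i ∈ s then μ.real A else 1 - μ.real A := by
    intro i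
    split_ifs
    · rfl
    · exact probReal_compl_eq_one_sub hA
  rw [Finset.prod_congr rfl fun i _ => hterm i, Finset.prod_ite, Finset.prod_const,
    Finset.prod_const, mul_comm]
  congr 2
  · rw [Finset.filter_not, Finset.card_sdiff_of_subset (Finset.filter_subset _ _)]
    simp
  · simp

/-- The number of successes in `K` independent trials is binomially distributed. -/
theorem pi_real_ncard_le {A : Set Ω} (hA : MeasurableSet A) (K L : ℕ) :
    (Measure.pi fun _ : Fin K => μ).real {U | {i | U i ∈ A}.ncard ≤ L} =
      binomialCDF K L (μ.real A) := by
  classical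
  have hmeas : ∀ s : Finset (Fin K), MeasurableSet {U : Fin K → Ω | ∀ i, U i ∈ A ↔ i ∈ s} := by
    intro s
    simp only [Set.ofPred_forall]
    refine MeasurableSet.iInter fun i => ?_
    exact (measurable_pi_apply i hA).iff (MeasurableSet.const _)
  -- Partition by the exact set of successes; grouping these sets by cardinality produces the
  -- binomial coefficients.
  have hset : {U : Fin K → Ω | {i | U i ∈ A}.ncard ≤ L} =
      ⋃ s ∈ (Finset.univ.powerset.filter fun s : Finset (Fin K) => s.card ≤ L),
        {U : Fin K → Ω | ∀ i, U i ∈ A ↔ i ∈ s} := by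
    ext U
    simp only [Set.mem_ofPred_eq, Finset.powerset_univ, Finset.mem_filter, Finset.mem_univ,
      true_and, Set.mem_iUnion, exists_prop]
    constructor
    · intro h
      refine ⟨Finset.univ.filter fun i => U i ∈ A, ?_, by simp⟩
      rwa [← Set.ncard_coe_finset, Finset.coe_filter_univ]
    · rintro ⟨s, hs, hU⟩
      have : {i | U i ∈ A} = (s : Set (Fin K)) := by
        ext i
        simpa using hU i
      rwa [this, Set.ncard_coe_finset]
  rw [hset, measureReal_biUnion_finset ?_ fun s _ => hmeas s]
  · rw [Finset.sum_congr rfl fun s _ => pi_real_setOf_mem_eq μ hA s, Finset.sum_filter,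
      Finset.sum_powerset_apply_card
        (fun m => if m ≤ L then (1 - μ.real A) ^ (K - m) * μ.real A ^ m else 0),
      Finset.card_univ, Fintype.card_fin, ← sum_range_filter_le]
    simp only [nsmul_eq_mul]
  · intro s _ t _ hst
    refine Set.disjoint_left.2 fun U hs ht => hst ?_
    ext i
    exact (hs i).symm.trans (ht i)

end IndependentTrials

/-! ### Measurability of reachability probabilities -/

namespace MarkovChain

variable {S : Type*} [Fintype S] [MeasurableSpace S] [DiscreteMeasurableSpace S]
  (D : MarkovChain S)

instance : IsProbabilityMeasure D.pathMeasure :=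
  inferInstanceAs (IsProbabilityMeasure (Kernel.trajMeasure _ _))

theorem pathMeasure_map_frestrictLe_zero :
    D.pathMeasure.map (Preorder.frestrictLe 0) =
      (Measure.dirac D.init).map
        (MeasurableEquiv.piUnique (fun _ : Finset.Iic 0 => S)).symm := by
  rw [pathMeasure, Kernel.trajMeasure, Measure.map_comp _ _ (by fun_prop),
    Kernel.traj_map_frestrictLe, Kernel.partialTraj_self]
  exact Measure.id_comp

/-- The Markov property: evaluate the joint law of prefix and next state on a product of singletons.
-/
theorem pathMeasure_map_frestrictLe_succ (n : ℕ) (x : Π _ : Finset.Iic (n + 1), S) :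
    D.pathMeasure.map (Preorder.frestrictLe (n + 1)) {x} =
      D.pathMeasure.map (Preorder.frestrictLe n)
          {Preorder.frestrictLe₂ (π := fun _ => S) n.le_succ x} *
        ENNReal.ofReal (D.trans (x ⟨n, Finset.mem_Iic.2 n.le_succ⟩)
          (x ⟨n + 1, Finset.mem_Iic.2 le_rfl⟩)) := by
  have hmap : D.pathMeasure.map (Preorder.frestrictLe n) ⊗ₘ D.historyKernel n =
      D.pathMeasure.map (fun ω => (Preorder.frestrictLe n ω, ω (n + 1))) :=
    Kernel.map_frestrictLe_trajMeasure_compProd_eq_map_trajMeasure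
  have hpair := congrArg (fun m => m ({Preorder.frestrictLe₂ (π := fun _ => S) n.le_succ x} ×ˢ
    {x ⟨n + 1, Finset.mem_Iic.2 le_rfl⟩})) hmap
  rw [Measure.compProd_apply_prod (.singleton _) (.singleton _), lintegral_singleton,
    Measure.map_apply (by fun_prop) ((MeasurableSet.singleton _).prod (.singleton _))] at hpair
  rw [Measure.map_apply (by fun_prop) (.singleton _), mul_comm]
  have hstep : D.historyKernel n (Preorder.frestrictLe₂ (π := fun _ => S) n.le_succ x)
      {x ⟨n + 1, Finset.mem_Iic.2 le_rfl⟩} =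
      ENNReal.ofReal (D.trans (x ⟨n, Finset.mem_Iic.2 n.le_succ⟩)
          (x ⟨n + 1, Finset.mem_Iic.2 le_rfl⟩)) := by
    change (D.stepPMF _).toMeasure _ = _
    rw [PMF.toMeasure_apply_singleton _ _ (.singleton _)]
    rfl
  rw [← hstep, hpair]
  congr 1
  ext ω
  simp only [Set.mem_preimage, Set.mem_singleton_iff, Set.mem_prod, funext_iff, Subtype.forall,
    Finset.mem_Iic, Preorder.frestrictLe_apply, Preorder.frestrictLe₂_apply]
  constructor
  · exact fun h => ⟨fun a ha => h a (ha.trans n.le_succ), h _ le_rfl⟩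
  · rintro ⟨h, h'⟩ a ha
    rcases Nat.le_succ_iff.1 ha with ha | rfl
    · exact h a ha
    · exact h'

/-- The events of reaching `T` by time `n` increase to the event of ever reaching it; continuity
from below applies. -/
theorem reachProb_eq_iSup (T : Set S) :
    D.reachProb T = (⨆ n, D.pathMeasure.map (Preorder.frestrictLe n)
      {x : Π _ : Finset.Iic n, S | ∃ i, x i ∈ T}).toReal := by
  have hset : {ω : ℕ → S | ∃ n, ω n ∈ T} = ⋃ n, Preorder.frestrictLe n ⁻¹'
      {x : Π _ : Finset.Iic n, S | ∃ i, x i ∈ T} := by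
    ext ω
    simp only [Set.mem_ofPred_eq, Set.mem_iUnion, Set.mem_preimage, Subtype.exists,
      Finset.mem_Iic, Preorder.frestrictLe_apply]
    exact ⟨fun ⟨n, hn⟩ => ⟨n, n, le_rfl, hn⟩, fun ⟨_, n, _, hn⟩ => ⟨n, hn⟩⟩
  rw [reachProb, measureReal_def, hset, Monotone.measure_iUnion]
  · congr 2
    ext n
    rw [Measure.map_apply (by fun_prop) (Set.toFinite _).measurableSet]
  · intro m n hmn ω
    simp only [Set.mem_preimage, Set.mem_ofPred_eq, Subtype.exists, Finset.mem_Iic,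
      Preorder.frestrictLe_apply]
    exact fun ⟨i, hi, h⟩ => ⟨i, hi.trans hmn, h⟩

/-- The reachability probability depends measurably on the transition probabilities. -/
theorem measurable_reachProb {Θ : Type*} [MeasurableSpace Θ] (D : Θ → MarkovChain S) (s₀ : S)
    (hinit : ∀ θ, (D θ).init = s₀) (htrans : ∀ s s', Measurable fun θ => (D θ).trans s s')
    (T : Set S) : Measurable fun θ => (D θ).reachProb T := by
  have hsingle : ∀ n (x : Π _ : Finset.Iic n, S),
      Measurable fun θ => (D θ).pathMeasure.map (Preorder.frestrictLe n) {x} := by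
    intro n
    induction n with
    | zero =>
      intro x
      simp only [pathMeasure_map_frestrictLe_zero, hinit]
      exact measurable_const
    | succ n ih =>
      intro x
      simp only [pathMeasure_map_frestrictLe_succ]
      exact (ih _).mul (htrans _ _).ennreal_ofReal
  simp only [reachProb_eq_iSup]
  refine (Measurable.iSup fun n => ?_).ennreal_toReal
  classical
  have hsum : ∀ θ, (D θ).pathMeasure.map (Preorder.frestrictLe n)
      {x : Π _ : Finset.Iic n, S | ∃ i, x i ∈ T} =
      ∑ x ∈ Finset.univ.filter (fun x : Π _ : Finset.Iic n, S => ∃ i, x i ∈ T),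
        (D θ).pathMeasure.map (Preorder.frestrictLe n) {x} := by
    intro θ
    rw [sum_measure_singleton, Finset.coe_filter_univ]
  simp only [hsum]
  exact Finset.measurable_fun_sum _ fun x _ => hsingle n x

end MarkovChain

/-! ### Violation counts and the confidence bound -/

namespace UncertainMC

variable {S V : Type*} [Fintype S] [MeasurableSpace S] [DiscreteMeasurableSpace S] [Fintype V]
  (M : UncertainMC S V)

theorem measurableSet_satSet (lam : ℝ) (T : Set S) : MeasurableSet (M.satSet lam T) := by
  have h : Measurable fun u : M.paramSpace => (M.instantiate u).reachProb T := by
    refine MarkovChain.measurable_reachProb (fun u => M.instantiate u) M.init (fun _ => rfl)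
      (fun s s' => ?_) T
    change Measurable fun u : M.paramSpace => MvPolynomial.aeval u.1 (M.trans s s')
    have hc : Continuous fun v : V → ℝ => MvPolynomial.aeval v (M.trans s s') := by
      simp only [MvPolynomial.aeval_def, MvPolynomial.eval₂_eq]
      fun_prop
    exact hc.measurable.comp measurable_subtype_coe
  exact measurableSet_le h measurable_const

theorem satProb_eq (lam : ℝ) (T : Set S) :
    M.satProb lam T = 1 - (M.prob : Measure M.paramSpace).real (M.satSet lam T)ᶜ := by
  rw [satProb, integral_indicator_const _ (M.measurableSet_satSet lam T),
    probReal_compl_eq_one_sub (M.measurableSet_satSet lam T)]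
  simp

theorem sampleMeasure_real_violating_le (lam : ℝ) (T : Set S) (K L : ℕ) :
    (M.sampleMeasure K).real {U | (M.violating lam T U).ncard ≤ L} =
      binomialCDF K L ((M.prob : Measure M.paramSpace).real (M.satSet lam T)ᶜ) :=
  pi_real_ncard_le _ (M.measurableSet_satSet lam T).compl K L


instance (K : ℕ) : IsProbabilityMeasure (M.sampleMeasure K) :=
  inferInstanceAs (IsProbabilityMeasure (Measure.pi _))

end UncertainMC

/-- Subadditivity on `A ∪ B` suffices, so neither set has to be measurable. -/
theorem one_sub_le_measureReal_of_compl_subset {Ω : Type*} [MeasurableSpace Ω] {μ : Measure Ω}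
    [IsProbabilityMeasure μ] {A B : Set Ω} {c : ℝ} (hAB : Aᶜ ⊆ B) (hB : μ.real B ≤ c) :
    1 - c ≤ μ.real A := by
  have h1 : μ.real (A ∪ B) = 1 := by
    rw [show A ∪ B = Set.univ from Set.eq_univ_of_forall fun x =>
      (em (x ∈ A)).imp_right fun h => hAB h, probReal_univ]
  linarith [measureReal_union_le (μ := μ) A B]

theorem mainTheorem6 {S V : Type*} [Fintype S] [MeasurableSpace S] [DiscreteMeasurableSpace S]
    [Fintype V] (M : UncertainMC S V) (T : Set S) (lam : ℝ) (hlam : lam ∈ Set.Icc (0 : ℝ) 1)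
    (K : ℕ) (hK : 2 ≤ K) (ν : ℝ) (hν : ν ∈ Set.Ico (0 : ℝ) 1) :
    -- for every number `L` of discarded samples
    (∀ L : ℕ, 1 - confidenceProb K L ν ≤
      (M.sampleMeasure K).real
        {U | (M.violating lam T U).ncard = L → 1 - ν ≤ M.satProb lam T}) ∧
    -- the number of discarded samples is read off from the random sample
    (∀ β : ℝ, 0 ≤ β → 1 - β ≤
      (M.sampleMeasure K).real
        {U | confidenceProb K (M.violating lam T U).ncard ν ≤ β → 1 - ν ≤ M.satProb lam T}) := by
  obtain ⟨hν0, hν1⟩ := hν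
  have hle : ∀ L, M.satProb lam T < 1 - ν →
      (M.sampleMeasure K).real {U | (M.violating lam T U).ncard ≤ L} ≤ confidenceProb K L ν := by
    intro L hF
    rw [M.satProb_eq] at hF
    rw [M.sampleMeasure_real_violating_le]
    exact binomialCDF_le_confidenceProb hν0 (by linarith) measureReal_le_one K L
  have htriv : ∀ {c : ℝ} {A : Set (Fin K → M.paramSpace)}, 0 ≤ c → Aᶜ ⊆ ∅ →
      1 - c ≤ (M.sampleMeasure K).real A := fun hc hA =>
    one_sub_le_measureReal_of_compl_subset hA (by simpa using hc)
  rcases le_or_gt (1 - ν) (M.satProb lam T) with hF | hF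
  · refine ⟨fun L => htriv ?_ fun U hU => hU fun _ => hF, fun β hβ =>
      htriv hβ fun U hU => hU fun _ => hF⟩
    rw [confidenceProb_eq]
    exact mul_nonneg (by positivity) (binomialCDF_nonneg hν0 hν1.le _ _)
  refine ⟨fun L => one_sub_le_measureReal_of_compl_subset (fun U hU => ?_) (hle L hF),
    fun β hβ => ?_⟩
  · simp only [Set.mem_compl_iff, Set.mem_ofPred_eq, Classical.not_imp] at hU
    exact hU.1.le
  -- the largest admissible number of discarded samples bounds the observed one
  classical
  -- `Nat.findGreatest` defaults to 0 when nothing is admissible, so that case is split off: there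
  -- the premise never holds, as the count is at most `K`.
  by_cases hex : ∃ L ≤ K, confidenceProb K L ν ≤ β
  · obtain ⟨L, hLK, hL⟩ := hex
    set m := Nat.findGreatest (fun L => confidenceProb K L ν ≤ β) K
    have hm : confidenceProb K m ν ≤ β :=
      Nat.findGreatest_spec (P := fun L => confidenceProb K L ν ≤ β) hLK hL
    refine one_sub_le_measureReal_of_compl_subset (fun U hU => ?_) ((hle m hF).trans hm)
    simp only [Set.mem_compl_iff, Set.mem_ofPred_eq, Classical.not_imp] at hU
    exact Nat.le_findGreatest
      ((Set.ncard_le_card _).trans_eq (by simp)) hU.1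
  · refine htriv hβ fun U hU => hex ?_
    simp only [Set.mem_compl_iff, Set.mem_ofPred_eq, Classical.not_imp] at hU
    exact ⟨_, (Set.ncard_le_card _).trans_eq (by simp), hU.1⟩
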